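/- Let $(Y_n)_{n\ge 0}$ be i.i.d. non-negative real random variables with common distribution $\mu$ and distribution function $F_\mu(x)=\mu([0,x])$, and suppose that $\mu$ is non-lattice: there is no $\kappa>0$ with $\operatorname{supp}(\mu)\subset\{0,\kappa,2\kappa,\dots\}$. Let $N=\sup\operatorname{supp}(\mu)\in(0,\infty]$, and let $\mathcal C=[0,N]$ if $N<\infty$, $\mathcal C=[0,\infty)$ if $N=\infty$. For $x\ge 0$ let $X_0^x=x$ and $X_{n+1}^x=|X_n^x-Y_{n+1}|$ be the reflected random walk starting at $x$, with transition kernel $p(x,B)=\mu(\{y: |x-y|\in B\})$. An invariant Radon measure on $\mathcal C$ is a non-zero Borel measure $m$ on $\mathcal C$, finite on bounded sets, with $\int p(x,B)\,m(dx)=m(B)$ for all Borel sets $B$. Suppose that $$\int_0^\infty \bigl(1-F_\mu(x)\bigr)^2\,dx<\infty .$$ Then for every starting point $x\ge 0$ the reflected random walk $(X_n^x)$ is topologically recurrent: for every non-empty bounded open interval $J=(a,b)\subset\mathcal C$, $$\mathbb P\Bigl[\sum_{n=0}^\infty \mathbf 1_J(X_n^x)=\infty\Bigr]=1 .$$ If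 in addition $\mathbb E(Y_1)<\infty$, then $(X_n^x)$ is positive recurrent, that is, it is topologically recurrent, an invariant Radon measure on $\mathcal C$ exists, and every such measure has finite total mass. If instead $\mathbb E(Y_1)=\infty$, then $(X_n^x)$ is null recurrent, that is, it is topologically recurrent, an invariant Radon measure on $\mathcal C$ exists, and every such measure has infinite total mass. -/

import Mathlib

open MeasureTheory ProbabilityTheory Filter Set
open scoped ENNReal

namespace ReflectedWalk

/-- The reflected random walk `X_n^x` driven by the sequence `Y`: it starts at `X_0^x = x`, and
`X_{n+1}^x = |X_n^x - Y_{n+1}|`. -/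
def walk {Ω : Type*} (Y : ℕ → Ω → ℝ) (x : ℝ) : ℕ → Ω → ℝ
  | 0, _ => x
  | n + 1, ω => |walk Y x n ω - Y (n + 1) ω|

/-- The law `μ` is lattice if its topological support is contained in `κ · {0, 1, 2, …}` for some
`κ > 0`. -/
def IsLattice (μ : Measure ℝ) : Prop :=
  ∃ κ : ℝ, 0 < κ ∧ μ.support ⊆ Set.range (fun k : ℕ => κ * (k : ℝ))

/-- The right end point `N = sup supp(μ)`, possibly `∞`. -/
noncomputable def rightEnd (μ : Measure ℝ) : EReal :=
  ⨆ y ∈ μ.support, (y : EReal)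

/-- The essential interval `C`: it is `[0, N]` if `N = sup supp(μ)` is finite, and `[0, ∞)`
if `N = ∞`. -/
def essInterval (μ : Measure ℝ) : Set ℝ :=
  {x : ℝ | 0 ≤ x ∧ (x : EReal) ≤ rightEnd μ}

/-- The transition kernel `p(x, B) = μ {y | |x - y| ∈ B}` of the reflected random walk. -/
noncomputable def transition (μ : Measure ℝ) [IsProbabilityMeasure μ] : Kernel ℝ ℝ where
  toFun x := μ.map (fun y => |x - y|)
  measurable' := by
    refine Measure.measurable_of_measurable_coe _ fun B hB => ?_
    have hf : Measurable (fun p : ℝ × ℝ => |p.1 - p.2|) := by fun_prop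
    have h := measurable_measure_prodMk_left (ν := μ) (hf hB)
    have e : (fun x : ℝ => μ.map (fun y => |x - y|) B) =
        fun x => μ (Prod.mk x ⁻¹' ((fun p : ℝ × ℝ => |p.1 - p.2|) ⁻¹' B)) := by
      funext x
      rw [Measure.map_apply (by fun_prop) hB]
      rfl
    rw [e]
    exact h

/-- `m` is a non-zero Radon measure on the essential interval `C` (on `ℝ`, a Borel measure that is
finite on compact sets is Radon) which is invariant for the transition kernel:
`∫ p(x, B) m(dx) = m(B)`. -/
structure IsInvariantRadon (μ : Measure ℝ) [IsProbabilityMeasure μ] (m : Measure ℝ) : Prop where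
  ne_zero : m ≠ 0
  concentrated : m (essInterval μ)ᶜ = 0
  finite_on_compacts : IsFiniteMeasureOnCompacts m
  invariant : Kernel.Invariant (transition μ) m

/-- Topological recurrence of `(X_n^x)`: every non-empty bounded open interval `(a, b) ⊆ C` is
visited infinitely often with probability one. -/
def IsTopologicallyRecurrent {Ω : Type*} [MeasurableSpace Ω] (P : Measure Ω) (Y : ℕ → Ω → ℝ)
    (μ : Measure ℝ) (x : ℝ) : Prop :=
  ∀ a b : ℝ, a < b → Ioo a b ⊆ essInterval μ →
    ∀ᵐ ω ∂P, ∃ᶠ n in atTop, walk Y x n ω ∈ Ioo a b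

/-- Positive recurrence: topological recurrence, and the invariant Radon measures on `C` exist and
have finite total mass. -/
def IsPositiveRecurrent {Ω : Type*} [MeasurableSpace Ω] (P : Measure Ω) (Y : ℕ → Ω → ℝ)
    (μ : Measure ℝ) [IsProbabilityMeasure μ] (x : ℝ) : Prop :=
  IsTopologicallyRecurrent P Y μ x ∧ (∃ m, IsInvariantRadon μ m) ∧
    ∀ m, IsInvariantRadon μ m → m Set.univ < ∞

/-- Null recurrence: topological recurrence, and the invariant Radon measures on `C` exist and
have infinite total mass. -/
def IsNullRecurrent {Ω : Type*} [MeasurableSpace Ω] (P : Measure Ω) (Y : ℕ → Ω → ℝ)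
    (μ : Measure ℝ) [IsProbabilityMeasure μ] (x : ℝ) : Prop :=
  IsTopologicallyRecurrent P Y μ x ∧ (∃ m, IsInvariantRadon μ m) ∧
    ∀ m, IsInvariantRadon μ m → m Set.univ = ∞

end ReflectedWalk

/-!
Write `F` for the distribution function of the increments. The walk always has the explicit
invariant measure `m(dx) = (1 - F(x)) dx` on `[0, ∞)` (`invariant_tailMeasure`), whose total mass is
the expectation of an increment (`tailMeasure_univ`).

Recurrence comes from `m`. The shift on trajectories preserves the product of `m` with the law of
the increments. The walk is reflected infinitely often, and the trajectories reflected at their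
first step have measure `∫ (1 - F) dm = ∫ (1 - F)²`, which is assumed to be finite. So almost every
orbit visits infinitely often a set of finite measure, and the shift is conservative by Maharam's
recurrence theorem (`conservative_of_ae_frequently_mem`, `conservative_trajShift`). Poincaré
recurrence then shows that almost every point of an interval returns to it infinitely often.

To reach all starting points, two walks are driven by the same increments. Their distance never
increases, and it decreases strictly along some path of increments from the support: otherwise all
paths would carry the midpoint of the two walkers to their midpoint, while in the non-lattice case
some path brings the midpoint closer to `0` than half the distance (`exists_orbit_lt`,
`exists_pair_orbit_dist_lt`). Hence every off-diagonal pair of positions has a neighbourhood that is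
visited finitely often only (`exists_nhds_visitProb_eq_zero`), and the distance tends to zero as
soon as one of the walks returns to a bounded set (`ae_tendsto_pairDist_of_frequently_le`). All
walks therefore follow a recurrent one (`ae_frequently_mem_Ioo`).

Finally, contraction makes the asymptotic behaviour of expectations along the walk independent of
the starting point; integrating this against two invariant Radon measures shows that both are finite
or both are infinite (`measure_univ_lt_top_of_isInvariantRadon`). Comparison with `m` decides
between positive and null recurrence.
-/

namespace ReflectedWalk

open scoped Topology

/-! ### Orbits of the reflections -/

/-- One reflected step from `x` to `x'` with an increment in `S`. -/
def StepRel (S : Set ℝ) (x x' : ℝ) : Prop := ∃ s ∈ S, x' = |x - s|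

/-- Subtracting a positive increment `s` repeatedly reduces the position modulo `s`. -/
lemma StepRel.iterate_sub {S : Set ℝ} {s : ℝ} (hs : s ∈ S) (hs0 : 0 < s) {k : ℝ} (hk : 0 ≤ k) :
    ∃ n : ℤ, Relation.ReflTransGen (StepRel S) k (k + n * s) ∧ 0 ≤ k + n * s ∧ k + n * s < s := by
  have key : ∀ (N : ℕ) (k : ℝ), 0 ≤ k → k < N * s → ∃ n : ℤ,
      Relation.ReflTransGen (StepRel S) k (k + n * s) ∧ 0 ≤ k + n * s ∧ k + n * s < s := by
    intro N
    induction N with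
    | zero => intro k h0 h1; norm_num at h1; linarith
    | succ N ih =>
      intro k h0 h1
      by_cases hks : k < s
      · exact ⟨0, by simpa using Relation.ReflTransGen.refl, by simpa, by simpa⟩
      · push Not at hks
        obtain ⟨n, hn, h2, h3⟩ := ih (k - s) (by linarith) (by push_cast at h1; linarith)
        have e : k - s + n * s = k + ((n - 1 : ℤ) : ℝ) * s := by push_cast; ring
        rw [e] at hn h2 h3
        refine ⟨n - 1, Relation.ReflTransGen.head ⟨s, hs, ?_⟩ hn, h2, h3⟩
        rw [abs_of_nonneg (by linarith)]
  obtain ⟨N, hN⟩ := exists_nat_gt (k / s)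
  exact key N k hk (by rwa [div_lt_iff₀ hs0] at hN)

/-- From every starting point, reflected steps with increments in a non-lattice set come
arbitrarily close to `0`: modulo a positive increment `s₁`, the orbit is invariant under the group
generated by all increments, and that group is dense. -/
lemma exists_orbit_lt {S : Set ℝ} (hS0 : ∀ s ∈ S, 0 ≤ s)
    (hS : ¬ ∃ κ : ℝ, 0 < κ ∧ S ⊆ Set.range (fun k : ℕ => κ * (k : ℝ)))
    {w η : ℝ} (hw : 0 ≤ w) (hη : 0 < η) :
    ∃ k, Relation.ReflTransGen (StepRel S) w k ∧ k < η := by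
  obtain ⟨s₁, hs₁, hpos⟩ : ∃ s ∈ S, 0 < s := by
    by_contra! h
    exact hS ⟨1, one_pos, fun s hs => ⟨0, by simpa using le_antisymm (hS0 s hs) (h s hs)⟩⟩
  have hnn : ∀ k, Relation.ReflTransGen (StepRel S) w k → 0 ≤ k := by
    intro k hk
    cases hk with
    | refl => exact hw
    | tail _ h => obtain ⟨s, _, rfl⟩ := h; exact abs_nonneg _
  -- `E` is the orbit modulo `s₁`.
  let E : Set ℝ := {t | ∃ k, Relation.ReflTransGen (StepRel S) w k ∧ ∃ n : ℤ, t = k + n * s₁}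
  -- Reducing `k` into `[0, s₁)` and reflecting once more at `s₁` gives the class of `-k`.
  have hneg : ∀ t ∈ E, -t ∈ E := by
    rintro t ⟨k, hk, n, rfl⟩
    obtain ⟨j, hj, h0, h1⟩ := StepRel.iterate_sub hs₁ hpos (hnn k hk)
    refine ⟨|k + j * s₁ - s₁|, (hk.trans hj).tail ⟨s₁, hs₁, rfl⟩, j - 1 - n, ?_⟩
    rw [abs_of_neg (by linarith)]
    push_cast; ring
  have hsub : ∀ t ∈ E, ∀ s ∈ S, t - s ∈ E := by
    rintro t ⟨k, hk, n, rfl⟩ s hs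
    have h1 : |k - s| ∈ E := ⟨_, hk.tail ⟨s, hs, rfl⟩, 0, by simp⟩
    have h2 : k - s ∈ E := by
      rcases abs_choice (k - s) with h | h
      · rwa [h] at h1
      · rw [h] at h1; simpa using hneg _ h1
    obtain ⟨k', hk', n', h⟩ := h2
    exact ⟨k', hk', n + n', by push_cast; linarith⟩
  have hadd : ∀ t ∈ E, ∀ s ∈ S, t + s ∈ E := by
    intro t ht s hs
    have := hneg _ (hsub _ (hneg _ ht) s hs)
    rwa [show -(-t - s) = t + s by ring] at this
  have hgrp : ∀ g ∈ AddSubgroup.closure S, ∀ t ∈ E, t + g ∈ E := by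
    intro g hg
    induction hg using AddSubgroup.closure_induction with
    | mem x hx => exact fun t ht => hadd t ht x hx
    | zero => simp
    | add x y _ _ hx hy => intro t ht; rw [← add_assoc]; exact hy _ (hx _ ht)
    | neg x _ hx =>
      intro t ht
      have := hneg _ (hx _ (hneg _ ht))
      rwa [show -(-t + x) = t + -x by ring] at this
  have hdense : Dense (AddSubgroup.closure S : Set ℝ) := by
    rcases AddSubgroup.dense_or_cyclic (AddSubgroup.closure S) with h | ⟨a, ha⟩
    · exact h
    · exfalso
      have hmem : ∀ s ∈ S, ∃ n : ℤ, n • a = s := by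
        intro s hs
        have : s ∈ AddSubgroup.closure S := AddSubgroup.subset_closure hs
        rwa [ha, AddSubgroup.mem_closure_singleton] at this
      have ha0 : a ≠ 0 := by
        rintro rfl
        obtain ⟨n, hn⟩ := hmem _ hs₁
        simp at hn; linarith
      refine hS ⟨|a|, abs_pos.2 ha0, fun s hs => ?_⟩
      obtain ⟨n, rfl⟩ := hmem s hs
      refine ⟨n.natAbs, ?_⟩
      have h0 := hS0 _ hs
      simp only [zsmul_eq_mul] at h0 ⊢
      rw [Nat.cast_natAbs, Int.cast_abs, ← abs_mul, mul_comm, abs_of_nonneg h0]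
  obtain ⟨g, hg, hgm⟩ := hdense.exists_mem_open (isOpen_Ioo (a := -w) (b := -w + min η s₁))
    ⟨-w + min η s₁ / 2, by constructor <;> linarith [lt_min hη hpos]⟩
  obtain ⟨k, hk, n, hkn⟩ := hgrp g hg w ⟨w, .refl, 0, by simp⟩
  obtain ⟨j, hj, h0, h1⟩ := StepRel.iterate_sub hs₁ hpos (hnn k hk)
  refine ⟨_, hk.trans hj, ?_⟩
  -- The reduction of `k` and `w + g` lie in `[0, s₁)` and agree modulo `s₁`, so they coincide.
  have hm1 := min_le_left η s₁
  have hm2 := min_le_right η s₁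
  have hnj : (j : ℤ) = n := by
    have h2 : ((j - n : ℤ) : ℝ) * s₁ < 1 * s₁ := by push_cast; linarith [hgm.1]
    have h3 : (-1 : ℝ) * s₁ < ((j - n : ℤ) : ℝ) * s₁ := by push_cast; linarith [hgm.2]
    have h4 := lt_of_mul_lt_mul_right h2 hpos.le
    have h5 := lt_of_mul_lt_mul_right h3 hpos.le
    have h6 : j - n < 1 := by exact_mod_cast h4
    have h7 : -1 < j - n := by exact_mod_cast h5
    lia
  rw [hnj]; linarith [hgm.2]

/-- The reflected step of two walkers with a common increment. -/
def pairStep (z : ℝ × ℝ) (s : ℝ) : ℝ × ℝ := (|z.1 - s|, |z.2 - s|)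

/-- One joint reflected step from `z` to `z'` with a common increment in `S`. -/
def PairStepRel (S : Set ℝ) (z z' : ℝ × ℝ) : Prop := ∃ s ∈ S, z' = pairStep z s

/-- The distance of two walkers. -/
def pairDist (z : ℝ × ℝ) : ℝ := |z.1 - z.2|

lemma pairDist_pairStep_le (z : ℝ × ℝ) (s : ℝ) : pairDist (pairStep z s) ≤ pairDist z := by
  have := abs_abs_sub_abs_le_abs_sub (z.1 - s) (z.2 - s)
  simpa [pairDist, pairStep] using this

/-- If a common reflected step does not decrease the distance of two walkers, it reflects or
translates the whole segment between them, so it carries the midpoint to the midpoint. -/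
lemma midpoint_pairStep {z : ℝ × ℝ} {s : ℝ} (h : pairDist (pairStep z s) = pairDist z) :
    |(z.1 + z.2) / 2 - s| = ((pairStep z s).1 + (pairStep z s).2) / 2 := by
  simp only [pairDist, pairStep] at *
  grind

/-- Two distinct walkers can come strictly closer: if no path decreased their distance `d`, some
path would bring their midpoint below `d / 2`, and one of the two positions would be negative. -/
lemma exists_pair_orbit_dist_lt {S : Set ℝ} (hS0 : ∀ s ∈ S, 0 ≤ s)
    (hS : ¬ ∃ κ : ℝ, 0 < κ ∧ S ⊆ Set.range (fun k : ℕ => κ * (k : ℝ)))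
    {z : ℝ × ℝ} (h1 : 0 ≤ z.1) (h2 : 0 ≤ z.2) (hz : z.1 ≠ z.2) :
    ∃ z', Relation.ReflTransGen (PairStepRel S) z z' ∧ pairDist z' < pairDist z := by
  by_contra! hcon
  have hpos : 0 < pairDist z := abs_pos.2 (sub_ne_zero.2 hz)
  obtain ⟨k, hk, hlt⟩ := exists_orbit_lt hS0 hS (w := (z.1 + z.2) / 2) (η := pairDist z / 2)
    (by positivity) (by positivity)
  have key : ∃ z', Relation.ReflTransGen (PairStepRel S) z z' ∧ k = (z'.1 + z'.2) / 2 ∧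
      pairDist z' = pairDist z ∧ 0 ≤ z'.1 ∧ 0 ≤ z'.2 := by
    clear hlt
    induction hk with
    | refl => exact ⟨z, .refl, rfl, rfl, h1, h2⟩
    | tail _ hstep ih =>
      obtain ⟨s, hs, rfl⟩ := hstep
      obtain ⟨z', hz', rfl, hd, -, -⟩ := ih
      have hz'' : Relation.ReflTransGen (PairStepRel S) z (pairStep z' s) := hz'.tail ⟨s, hs, rfl⟩
      have e : pairDist (pairStep z' s) = pairDist z' :=
        le_antisymm (pairDist_pairStep_le _ _) (hd ▸ hcon _ hz'')
      exact ⟨_, hz'', midpoint_pairStep e, e.trans hd, abs_nonneg _, abs_nonneg _⟩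
  obtain ⟨z', -, rfl, hd, h3, h4⟩ := key
  rw [← hd, pairDist] at hlt
  rcases abs_cases (z'.1 - z'.2) with h | h <;> linarith

/-! ### The path space of the increments -/

/-- The law of an i.i.d. sequence of increments. -/
noncomputable def pathLaw (μ : Measure ℝ) [IsProbabilityMeasure μ] : Measure (ℕ → ℝ) :=
  Measure.infinitePi fun _ => μ

/-- The sequence of increments with its first term removed. -/
def tailSeq (y : ℕ → ℝ) : ℕ → ℝ := fun k => y (k + 1)

/-- The position after `n` steps of the reflected walk started at `x` whose successive increments
are `y 0, y 1, …`; the recursion peels off the first increment, as in the Markov property. -/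
def pathWalk : ℕ → ℝ → (ℕ → ℝ) → ℝ
  | 0, x, _ => x
  | n + 1, x, y => pathWalk n |x - y 0| (tailSeq y)

lemma pathWalk_succ' (n : ℕ) (x : ℝ) (y : ℕ → ℝ) :
    pathWalk (n + 1) x y = |pathWalk n x y - y n| := by
  induction n generalizing x y with
  | zero => rfl
  | succ n ih => rw [pathWalk, ih]; rfl

lemma walk_eq_pathWalk {Ω : Type*} (Y : ℕ → Ω → ℝ) (x : ℝ) (n : ℕ) (ω : Ω) :
    walk Y x n ω = pathWalk n x fun k => Y (k + 1) ω := by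
  induction n with
  | zero => rfl
  | succ n ih => rw [pathWalk_succ', walk, ih]

lemma pathWalk_nonneg {x : ℝ} (hx : 0 ≤ x) (n : ℕ) (y : ℕ → ℝ) : 0 ≤ pathWalk n x y := by
  cases n with
  | zero => exact hx
  | succ n => rw [pathWalk_succ']; exact abs_nonneg _

@[fun_prop]
lemma measurable_tailSeq : Measurable tailSeq := by
  unfold tailSeq; fun_prop

lemma measurable_pathWalk (n : ℕ) : Measurable fun p : ℝ × (ℕ → ℝ) => pathWalk n p.1 p.2 := by
  induction n with
  | zero => exact measurable_fst
  | succ n ih =>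
    have : Measurable fun p : ℝ × (ℕ → ℝ) => (|p.1 - p.2 0|, tailSeq p.2) := by fun_prop
    exact ih.comp this

@[fun_prop]
lemma measurable_pathWalk_comp {α : Type*} [MeasurableSpace α] {f : α → ℝ} {g : α → ℕ → ℝ} (n : ℕ)
    (hf : Measurable f) (hg : Measurable g) : Measurable fun a => pathWalk n (f a) (g a) :=
  (measurable_pathWalk n).comp (hf.prodMk hg)

section PathSpace

variable (μ : Measure ℝ) [IsProbabilityMeasure μ]

instance : IsProbabilityMeasure (pathLaw μ) := by unfold pathLaw; infer_instance

lemma pathLaw_eq_map_cons :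
    pathLaw μ = (μ.prod (pathLaw μ)).map fun p n => Nat.casesOn n p.1 p.2 := by
  symm
  refine Measure.eq_infinitePi _ fun s t ht => ?_
  have hm : Measurable fun (p : ℝ × (ℕ → ℝ)) (n : ℕ) => (Nat.casesOn n p.1 p.2 : ℝ) := by
    refine measurable_pi_iff.2 fun n => ?_
    cases n <;> simp only <;> fun_prop
  classical
  obtain ⟨n, hn⟩ : ∃ n, s ⊆ Finset.range (n + 1) := by
    obtain ⟨n, hn⟩ := s.exists_nat_subset_range
    exact ⟨n, hn.trans (Finset.range_mono (Nat.le_succ n))⟩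
  let t' : ℕ → Set ℝ := fun i => if i ∈ s then t i else univ
  have ht' : ∀ i, MeasurableSet (t' i) := by
    intro i; by_cases h : i ∈ s <;> simp [t', h, ht]
  have e1 : Set.pi (s : Set ℕ) t = Set.pi (Finset.range (n + 1) : Set ℕ) t' := by
    ext y
    simp only [Set.mem_pi, Finset.mem_coe]
    constructor
    · intro h i _
      by_cases his : i ∈ s
      · simpa [t', his] using h i his
      · simp [t', his]
    · intro h i hi
      simpa [t', hi] using h i (hn hi)
  have e2 : ∏ i ∈ s, μ (t i) = ∏ i ∈ Finset.range (n + 1), μ (t' i) := by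
    rw [← Finset.prod_subset hn]
    · exact Finset.prod_congr rfl fun i hi => by simp [t', hi]
    · intro i _ hi; simp [t', hi]
  have e3 : (fun (p : ℝ × (ℕ → ℝ)) (n : ℕ) => (Nat.casesOn n p.1 p.2 : ℝ)) ⁻¹'
      Set.pi (Finset.range (n + 1) : Set ℕ) t' =
      t' 0 ×ˢ Set.pi (Finset.range n : Set ℕ) fun i => t' (i + 1) := by
    ext p
    simp only [Set.mem_preimage, Set.mem_pi, Finset.mem_coe, Finset.mem_range, Set.mem_prod]
    constructor
    · exact fun h => ⟨h 0 (by lia), fun i hi => h (i + 1) (by lia)⟩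
    · rintro ⟨h0, h⟩ i hi
      cases i with
      | zero => exact h0
      | succ i => exact h i (by lia)
  rw [e1, Measure.map_apply hm (MeasurableSet.pi (Finset.countable_toSet _) fun i _ => ht' i), e3,
    Measure.prod_prod, e2, Finset.prod_range_succ', mul_comm, pathLaw,
    Measure.infinitePi_pi _ fun i _ => ht' (i + 1)]

lemma map_headTail_pathLaw :
    (pathLaw μ).map (fun y => (y 0, tailSeq y)) = μ.prod (pathLaw μ) := by
  have hm : Measurable fun (p : ℝ × (ℕ → ℝ)) (n : ℕ) => (Nat.casesOn n p.1 p.2 : ℝ) := by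
    refine measurable_pi_iff.2 fun n => ?_
    cases n <;> simp only <;> fun_prop
  conv_lhs => rw [pathLaw_eq_map_cons]
  rw [Measure.map_map (by fun_prop) hm]
  exact Measure.map_id

/-- The Markov property at time one: the first increment is independent of the others. -/
lemma lintegral_pathLaw {f : ℝ → (ℕ → ℝ) → ℝ≥0∞} (hf : Measurable (Function.uncurry f)) :
    ∫⁻ y, f (y 0) (tailSeq y) ∂pathLaw μ = ∫⁻ s, ∫⁻ y, f s y ∂pathLaw μ ∂μ := by
  have h := lintegral_prod (μ := μ) (ν := pathLaw μ) _ hf.aemeasurable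
  rw [← map_headTail_pathLaw, lintegral_map hf (by fun_prop)] at h
  exact h

lemma pathLaw_headTail {A : Set (ℝ × (ℕ → ℝ))} (hA : MeasurableSet A) :
    pathLaw μ {y | (y 0, tailSeq y) ∈ A} = ∫⁻ s, pathLaw μ {y | (s, y) ∈ A} ∂μ := by
  have h := Measure.prod_apply (μ := μ) (ν := pathLaw μ) hA
  rw [← map_headTail_pathLaw, Measure.map_apply (by fun_prop) hA] at h
  exact h

lemma measurePreserving_tailSeq : MeasurePreserving tailSeq (pathLaw μ) (pathLaw μ) := by
  refine ⟨by fun_prop, ?_⟩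
  have : tailSeq = Prod.snd ∘ fun y : ℕ → ℝ => (y 0, tailSeq y) := rfl
  rw [this, ← Measure.map_map (by fun_prop) (by fun_prop), map_headTail_pathLaw,
    Measure.map_snd_prod]
  simp

lemma map_eval_pathLaw (n : ℕ) : (pathLaw μ).map (fun y => y n) = μ :=
  Measure.infinitePi_map_eval (fun _ => μ) n

lemma iterate_tailSeq (n : ℕ) (y : ℕ → ℝ) : tailSeq^[n] y = fun k => y (k + n) := by
  induction n generalizing y with
  | zero => rfl
  | succ n ih => rw [Function.iterate_succ_apply, ih]; funext k; simp [tailSeq, add_assoc]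

lemma map_pathLaw_of_iIndepFun {Ω : Type*} [MeasurableSpace Ω] {P : Measure Ω}
    [IsProbabilityMeasure P] {Y : ℕ → Ω → ℝ} (hindep : iIndepFun Y P)
    (hlaw : ∀ n, HasLaw (Y n) μ P) :
    P.map (fun ω k => Y (k + 1) ω) = pathLaw μ ∧ AEMeasurable (fun ω k => Y (k + 1) ω) P := by
  have hm : ∀ k, AEMeasurable (Y (k + 1)) P := fun k => (hlaw _).aemeasurable
  refine ⟨?_, aemeasurable_pi_iff.2 hm⟩
  have h := hindep.precomp (g := fun k : ℕ => k + 1) (add_left_injective 1)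
  rw [iIndepFun_iff_map_fun_eq_infinitePi_map₀' hm] at h
  rw [h, pathLaw]
  congr 1
  funext k
  exact (hlaw _).map_eq

/-! ### Contraction of two coupled walks -/

/-- The positions after `n` steps of two walkers started at the coordinates of `z`. -/
def pairWalk (n : ℕ) (z : ℝ × ℝ) (y : ℕ → ℝ) : ℝ × ℝ := (pathWalk n z.1 y, pathWalk n z.2 y)

@[fun_prop]
lemma measurable_pairWalk_comp {α : Type*} [MeasurableSpace α] {f : α → ℝ × ℝ} {g : α → ℕ → ℝ}
    (n : ℕ) (hf : Measurable f) (hg : Measurable g) :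
    Measurable fun a => pairWalk n (f a) (g a) := by
  unfold pairWalk; fun_prop

lemma pairDist_pairWalk_antitone (z : ℝ × ℝ) (y : ℕ → ℝ) :
    Antitone fun n => pairDist (pairWalk n z y) := by
  refine antitone_nat_of_succ_le fun n => ?_
  have : pairWalk (n + 1) z y = pairStep (pairWalk n z y) (y n) := by
    simp [pairWalk, pairStep, pathWalk_succ']
  rw [this]
  exact pairDist_pairStep_le _ _

/-- The probability that two walkers started at `z` visit `U` infinitely often. -/
noncomputable def visitProb (U : Set (ℝ × ℝ)) (z : ℝ × ℝ) : ℝ≥0∞ :=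
  pathLaw μ {y | ∃ᶠ n in atTop, pairWalk n z y ∈ U}

lemma measurableSet_frequently {α : Type*} [MeasurableSpace α] {s : ℕ → Set α}
    (hs : ∀ n, MeasurableSet (s n)) : MeasurableSet {a | ∃ᶠ n in atTop, a ∈ s n} := by
  have : {a | ∃ᶠ n in atTop, a ∈ s n} = ⋂ N, ⋃ n, ⋃ (_ : N ≤ n), s n := by
    ext a; simp [frequently_atTop]
  rw [this]
  exact .iInter fun N => .iUnion fun n => .iUnion fun _ => hs n

lemma frequently_nat_succ {p : ℕ → Prop} : (∃ᶠ n in atTop, p (n + 1)) ↔ ∃ᶠ n in atTop, p n := by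
  conv_rhs => rw [← map_add_atTop_eq_nat 1, frequently_map]

variable {μ}
variable {U : Set (ℝ × ℝ)}

lemma measurableSet_visits (hU : MeasurableSet U) :
    MeasurableSet {p : (ℝ × ℝ) × (ℕ → ℝ) | ∃ᶠ n in atTop, pairWalk n p.1 p.2 ∈ U} :=
  measurableSet_frequently fun n =>
    (show Measurable fun p : (ℝ × ℝ) × (ℕ → ℝ) => pairWalk n p.1 p.2 by fun_prop) hU

lemma measurable_pairStep : Measurable fun p : (ℝ × ℝ) × ℝ => pairStep p.1 p.2 := by
  unfold pairStep; fun_prop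

/-- The Markov property at time one for an event of the path space of two walkers. -/
lemma pathLaw_pairStep {A : Set ((ℝ × ℝ) × (ℕ → ℝ))} (hA : MeasurableSet A) (z : ℝ × ℝ) :
    pathLaw μ {y | (pairStep z (y 0), tailSeq y) ∈ A} =
      ∫⁻ s, pathLaw μ {y | (pairStep z s, y) ∈ A} ∂μ := by
  have hm : Measurable fun p : ℝ × (ℕ → ℝ) => (pairStep z p.1, p.2) :=
    (measurable_pairStep.comp (measurable_const.prodMk measurable_fst)).prodMk measurable_snd
  exact pathLaw_headTail μ (hm hA)

lemma visitProb_eq_lintegral (hU : MeasurableSet U) (z : ℝ × ℝ) :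
    visitProb μ U z = ∫⁻ s, visitProb μ U (pairStep z s) ∂μ := by
  have h := pathLaw_pairStep (μ := μ) (measurableSet_visits hU) z
  refine Eq.trans ?_ h
  rw [visitProb]
  congr 1
  ext y
  exact (frequently_nat_succ (p := fun n => pairWalk n z y ∈ U)).symm

/-- First passage: a bound on the visit probability from the points of `U` holds everywhere, since
two walkers have to enter `U` before visiting it infinitely often. -/
lemma visitProb_le_of_forall_mem (hU : MeasurableSet U) {c : ℝ≥0∞}
    (hc : ∀ z ∈ U, visitProb μ U z ≤ c) (z : ℝ × ℝ) : visitProb μ U z ≤ c := by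
  -- `A n` asks in addition for a visit up to time `n`, which allows an induction on `n`.
  let A : ℕ → Set ((ℝ × ℝ) × (ℕ → ℝ)) := fun n =>
    {p | (∃ k ≤ n, pairWalk k p.1 p.2 ∈ U) ∧ ∃ᶠ n in atTop, pairWalk n p.1 p.2 ∈ U}
  have hA : ∀ n, MeasurableSet (A n) := by
    intro n
    have : {p : (ℝ × ℝ) × (ℕ → ℝ) | ∃ k ≤ n, pairWalk k p.1 p.2 ∈ U} =
        ⋃ k, ⋃ (_ : k ≤ n), {p | pairWalk k p.1 p.2 ∈ U} := by ext; simp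
    have hk : MeasurableSet {p : (ℝ × ℝ) × (ℕ → ℝ) | ∃ k ≤ n, pairWalk k p.1 p.2 ∈ U} := by
      rw [this]
      exact .iUnion fun k => .iUnion fun _ =>
        (show Measurable fun p : (ℝ × ℝ) × (ℕ → ℝ) => pairWalk k p.1 p.2 by fun_prop) hU
    exact hk.inter (measurableSet_visits hU)
  have key : ∀ n z, pathLaw μ {y | (z, y) ∈ A n} ≤ c := by
    intro n
    induction n with
    | zero =>
      intro z
      by_cases hz : z ∈ U
      · exact (measure_mono fun y hy => hy.2).trans (hc z hz)
      · have : {y | (z, y) ∈ A 0} = ∅ := by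
          ext y
          simp only [A, Set.mem_ofPred_eq, Set.mem_empty_iff_false, iff_false]
          rintro ⟨⟨k, hk, hkU⟩, -⟩
          obtain rfl := Nat.le_zero.1 hk
          exact hz hkU
        simp [this]
    | succ n ih =>
      intro z
      by_cases hz : z ∈ U
      · exact (measure_mono fun y hy => hy.2).trans (hc z hz)
      · calc pathLaw μ {y | (z, y) ∈ A (n + 1)}
            ≤ pathLaw μ {y | (pairStep z (y 0), tailSeq y) ∈ A n} := by
              refine measure_mono ?_
              rintro y ⟨⟨k, hk, hkU⟩, hfr⟩
              cases k with
              | zero => exact absurd hkU hz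
              | succ k => exact ⟨⟨k, by lia, hkU⟩, frequently_nat_succ.2 hfr⟩
          _ = ∫⁻ s, pathLaw μ {y | (pairStep z s, y) ∈ A n} ∂μ := pathLaw_pairStep (hA n) z
          _ ≤ ∫⁻ _, c ∂μ := lintegral_mono fun s => ih _
          _ = c := by simp
  have hun : {y | ∃ᶠ n in atTop, pairWalk n z y ∈ U} = ⋃ n, {y | (z, y) ∈ A n} := by
    ext y
    simp only [A, Set.mem_ofPred_eq, Set.mem_iUnion]
    refine ⟨fun h => ?_, fun ⟨n, h⟩ => h.2⟩
    obtain ⟨k, hk⟩ := h.exists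
    exact ⟨k, ⟨k, le_rfl, hk⟩, h⟩
  have hmono : Monotone fun n => {y | (z, y) ∈ A n} := by
    rintro a b hab y ⟨⟨k, hk, hkU⟩, hfr⟩
    exact ⟨⟨k, hk.trans hab, hkU⟩, hfr⟩
  rw [visitProb, hun, hmono.directed_le.measure_iUnion]
  exact iSup_le fun n => key n z

lemma continuous_pairDist : Continuous pairDist := by unfold pairDist; fun_prop

/-- If two walkers started at `z` can reach a distance below `r`, then from all points near `z` the
probability of visiting infinitely often a set of distances above `r` is at most a fixed proportion
of its supremum, because distances never increase. -/
lemma exists_visitProb_le_mul_iSup {r : ℝ} {z z' : ℝ × ℝ}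
    (h : Relation.ReflTransGen (PairStepRel μ.support) z z') (hz' : pairDist z' < r) :
    ∃ W ∈ 𝓝 z, ∃ c < 1, ∀ U, MeasurableSet U → (∀ u ∈ U, r < pairDist u) →
      ∀ u ∈ W, visitProb μ U u ≤ c * ⨆ v, visitProb μ U v := by
  induction h using Relation.ReflTransGen.head_induction_on with
  | refl =>
    refine ⟨{u | pairDist u < r}, (isOpen_lt continuous_pairDist continuous_const).mem_nhds hz',
      0, one_pos, fun U _ hUr u hu => ?_⟩
    have : {y | ∃ᶠ n in atTop, pairWalk n u y ∈ U} = ∅ := by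
      ext y
      simp only [Set.mem_ofPred_eq, Set.mem_empty_iff_false, iff_false]
      intro hfr
      obtain ⟨n, hn⟩ := hfr.exists
      have h1 := pairDist_pairWalk_antitone u y (Nat.zero_le n)
      have h2 := hUr _ hn
      have h3 : pairDist (pairWalk 0 u y) < r := hu
      simp only at h1
      linarith
    simp [visitProb, this]
  | @head a _ hstep _ ih =>
    obtain ⟨s, hs, rfl⟩ := hstep
    obtain ⟨W', hW', c', hc', h'⟩ := ih
    have hcont : Continuous fun p : (ℝ × ℝ) × ℝ => pairStep p.1 p.2 := by
      unfold pairStep; fun_prop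
    have hpre : (fun p : (ℝ × ℝ) × ℝ => pairStep p.1 p.2) ⁻¹' W' ∈ 𝓝 (a, s) :=
      hcont.continuousAt.preimage_mem_nhds hW'
    obtain ⟨W, hW, V, hV, hWV⟩ := mem_nhds_prod_iff.1 hpre
    obtain ⟨V₀, hV₀, hV₀o, hsV₀⟩ := mem_nhds_iff.1 hV
    have hμV : 0 < μ V₀ :=
      (Measure.mem_support_iff_forall s).1 hs V₀ (hV₀o.mem_nhds hsV₀)
    refine ⟨W, hW, c' * μ V₀ + μ V₀ᶜ, ?_, fun U hU hUr u hu => ?_⟩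
    · rw [← prob_add_prob_compl (μ := μ) hV₀o.measurableSet]
      refine ENNReal.add_lt_add_right (measure_ne_top _ _) ?_
      conv_rhs => rw [← one_mul (μ V₀)]
      exact ENNReal.mul_lt_mul_left hμV.ne' (measure_ne_top _ _) hc'
    · set M := ⨆ v, visitProb μ U v
      calc visitProb μ U u = ∫⁻ s, visitProb μ U (pairStep u s) ∂μ := visitProb_eq_lintegral hU u
        _ = ∫⁻ s in V₀, visitProb μ U (pairStep u s) ∂μ +
            ∫⁻ s in V₀ᶜ, visitProb μ U (pairStep u s) ∂μ :=
          (lintegral_add_compl _ hV₀o.measurableSet).symm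
        _ ≤ ∫⁻ _ in V₀, c' * M ∂μ + ∫⁻ _ in V₀ᶜ, M ∂μ := by
          refine add_le_add (setLIntegral_mono measurable_const fun s hs => ?_)
            (lintegral_mono fun s => le_iSup (visitProb μ U) _)
          exact h' U hU hUr _ (hWV (Set.mk_mem_prod hu (hV₀ hs)))
        _ = (c' * μ V₀ + μ V₀ᶜ) * M := by simp; ring

/-- Off the diagonal, every point has a neighbourhood that two walkers almost surely visit only
finitely often. -/
lemma exists_nhds_visitProb_eq_zero (hS0 : ∀ s ∈ μ.support, 0 ≤ s) (hS : ¬ IsLattice μ)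
    {z : ℝ × ℝ} (h1 : 0 ≤ z.1) (h2 : 0 ≤ z.2) (hz : z.1 ≠ z.2) :
    ∃ U ∈ 𝓝 z, ∀ u, visitProb μ U u = 0 := by
  obtain ⟨z', hzz', hlt⟩ := exists_pair_orbit_dist_lt hS0 hS h1 h2 hz
  obtain ⟨r, hr1, hr2⟩ := exists_between hlt
  obtain ⟨W, hW, c, hc, h⟩ := exists_visitProb_le_mul_iSup hzz' hr1
  obtain ⟨W₀, hW₀, hW₀o, hzW₀⟩ := mem_nhds_iff.1 hW
  have hUo : IsOpen (W₀ ∩ {u | r < pairDist u}) :=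
    hW₀o.inter (isOpen_lt continuous_const continuous_pairDist)
  refine ⟨W₀ ∩ {u | r < pairDist u}, hUo.mem_nhds ⟨hzW₀, hr2⟩, ?_⟩
  set U := W₀ ∩ {u | r < pairDist u}
  have hle : ⨆ u, visitProb μ U u ≤ c * ⨆ u, visitProb μ U u :=
    iSup_le <| visitProb_le_of_forall_mem hUo.measurableSet fun u hu =>
      h U hUo.measurableSet (fun _ hv => hv.2) u (hW₀ hu.1)
  have hfin : ⨆ u, visitProb μ U u ≠ ∞ :=
    ((iSup_le fun u => prob_le_one).trans_lt ENNReal.one_lt_top).ne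
  by_contra! hcon
  obtain ⟨u, hu⟩ := hcon
  have hpos : ⨆ u, visitProb μ U u ≠ 0 := fun h0 => hu (ENNReal.iSup_eq_zero.1 h0 u)
  have := ENNReal.mul_lt_mul_left hpos hfin hc
  rw [one_mul] at this
  exact absurd hle this.not_ge

/-- Contraction: the distance of two walkers with common increments tends to zero almost surely on
the event that one of them returns infinitely often to a bounded set. -/
lemma ae_tendsto_pairDist_of_frequently_le (hS0 : ∀ s ∈ μ.support, 0 ≤ s) (hS : ¬ IsLattice μ)
    {z : ℝ × ℝ} (h1 : 0 ≤ z.1) (h2 : 0 ≤ z.2) :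
    ∀ᵐ y ∂pathLaw μ, (∃ K, ∃ᶠ n in atTop, pathWalk n z.2 y ≤ K) →
      Tendsto (fun n => pairDist (pairWalk n z y)) atTop (𝓝 0) := by
  let Q : Set (ℝ × ℝ) := {z | 0 ≤ z.1 ∧ 0 ≤ z.2 ∧ z.1 ≠ z.2}
  have hex : ∀ z : ℝ × ℝ, ∃ U, z ∈ Q → U ∈ 𝓝 z ∧ ∀ u, visitProb μ U u = 0 := by
    intro z
    by_cases hz : z ∈ Q
    · obtain ⟨U, hU, h⟩ := exists_nhds_visitProb_eq_zero hS0 hS hz.1 hz.2.1 hz.2.2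
      exact ⟨U, fun _ => ⟨hU, h⟩⟩
    · exact ⟨∅, fun h => absurd h hz⟩
  choose U hU using hex
  -- Lindelöf: countably many of the neighbourhoods cover the complement of the diagonal.
  obtain ⟨t, htQ, htc, hcov⟩ := TopologicalSpace.countable_cover_nhdsWithin (s := Q)
    (f := fun z => interior (U z))
    fun z hz => mem_nhdsWithin_of_mem_nhds (interior_mem_nhds.2 (hU z hz).1)
  have hae : ∀ᵐ y ∂pathLaw μ, ∀ u ∈ t, ¬ ∃ᶠ n in atTop, pairWalk n z y ∈ U u := by
    rw [ae_ball_iff htc]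
    intro u hu
    have := (hU u (htQ hu)).2 z
    rw [ae_iff]
    simpa only [not_not, visitProb] using this
  filter_upwards [hae] with y hy
  rintro ⟨K, hK⟩
  set D : ℕ → ℝ := fun n => pairDist (pairWalk n z y)
  have hanti : Antitone D := pairDist_pairWalk_antitone z y
  have hD0 : ∀ n, 0 ≤ D n := fun n => abs_nonneg _
  have hlim := tendsto_atTop_ciInf hanti ⟨0, by rintro _ ⟨n, rfl⟩; exact hD0 n⟩
  set δ := ⨅ n, D n
  have hδD : ∀ n, δ ≤ D n := fun n => ciInf_le ⟨0, by rintro _ ⟨n, rfl⟩; exact hD0 n⟩ n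
  rcases (le_ciInf hD0 : 0 ≤ δ).eq_or_lt with h0 | hpos
  · exact h0 ▸ hlim
  exfalso
  -- If the limit `δ` of the distances is positive, the pairs accumulate off the diagonal.
  have hcomp : IsCompact (Icc (0 : ℝ × ℝ) (K + D 0, K) ∩ {u | δ ≤ pairDist u}) :=
    isCompact_Icc.inter_right (isClosed_le continuous_const continuous_pairDist)
  have hfr : ∃ᶠ n in atTop, pairWalk n z y ∈
      Icc (0 : ℝ × ℝ) (K + D 0, K) ∩ {u | δ ≤ pairDist u} := by
    refine hK.mono fun n hn => ⟨⟨⟨pathWalk_nonneg h1 n y, pathWalk_nonneg h2 n y⟩, ?_, hn⟩, hδD n⟩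
    have h3 : pathWalk n z.1 y - pathWalk n z.2 y ≤ D n := le_abs_self _
    have h4 := hanti (Nat.zero_le n)
    change pathWalk n z.1 y ≤ K + D 0
    linarith
  obtain ⟨u, hu, hclus⟩ := hcomp.exists_mapClusterPt_of_frequently hfr
  have huQ : u ∈ Q := by
    refine ⟨hu.1.1.1, hu.1.1.2, fun h => ?_⟩
    have : δ ≤ pairDist u := hu.2
    rw [pairDist, h, sub_self, abs_zero] at this
    linarith
  obtain ⟨v, hv, huv⟩ := Set.mem_iUnion₂.1 (hcov huQ)
  exact hy v hv (hclus.frequently (mem_interior_iff_mem_nhds.1 huv))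

end PathSpace

/-! ### Invariant measures -/

section Invariant

variable {μ : Measure ℝ} [IsProbabilityMeasure μ]

lemma lintegral_transition {f : ℝ → ℝ≥0∞} (hf : Measurable f) (x : ℝ) :
    ∫⁻ z, f z ∂transition μ x = ∫⁻ s, f |x - s| ∂μ := by
  change ∫⁻ z, f z ∂μ.map (fun y => |x - y|) = _
  rw [lintegral_map hf (by fun_prop)]

lemma measurable_lintegral_step {f : ℝ → ℝ≥0∞} (hf : Measurable f) :
    Measurable fun x => ∫⁻ s, f |x - s| ∂μ := by
  have : Measurable fun p : ℝ × ℝ => f |p.1 - p.2| := by fun_prop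
  exact this.lintegral_prod_right'

lemma lintegral_of_invariant {m : Measure ℝ} (hm : Kernel.Invariant (transition μ) m)
    {f : ℝ → ℝ≥0∞} (hf : Measurable f) : ∫⁻ x, ∫⁻ s, f |x - s| ∂μ ∂m = ∫⁻ x, f x ∂m := by
  conv_rhs => rw [← hm.def, Measure.lintegral_bind (Kernel.aemeasurable _) hf.aemeasurable]
  simp_rw [lintegral_transition hf]

lemma invariant_of_lintegral {m : Measure ℝ}
    (h : ∀ f : ℝ → ℝ≥0∞, Measurable f → ∫⁻ x, ∫⁻ s, f |x - s| ∂μ ∂m = ∫⁻ x, f x ∂m) :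
    Kernel.Invariant (transition μ) m := by
  refine Measure.ext fun B hB => ?_
  have hB' : Measurable (B.indicator (1 : ℝ → ℝ≥0∞)) := measurable_one.indicator hB
  rw [Measure.bind_apply hB (Kernel.aemeasurable _), ← lintegral_indicator_one hB, ← h _ hB']
  simp_rw [← lintegral_transition hB', lintegral_indicator_one hB]

lemma lintegral_pathWalk_of_invariant {m : Measure ℝ} (hm : Kernel.Invariant (transition μ) m)
    {f : ℝ → ℝ≥0∞} (hf : Measurable f) (n : ℕ) :
    ∫⁻ x, ∫⁻ y, f (pathWalk n x y) ∂pathLaw μ ∂m = ∫⁻ x, f x ∂m := by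
  induction n with
  | zero => simp [pathWalk]
  | succ n ih =>
    have hg : Measurable fun x => ∫⁻ y, f (pathWalk n x y) ∂pathLaw μ :=
      (hf.comp (measurable_pathWalk n)).lintegral_prod_right'
    rw [← ih, ← lintegral_of_invariant hm hg]
    refine lintegral_congr fun x => ?_
    exact lintegral_pathLaw μ (f := fun s y => f (pathWalk n |x - s| y)) (by fun_prop)

variable (μ) in
/-- The measure with density `x ↦ μ (x, ∞)` on the half-line. -/
noncomputable def tailMeasure : Measure ℝ :=
  (volume.restrict (Ici 0)).withDensity fun x => μ (Ioi x)

omit [IsProbabilityMeasure μ] in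
lemma antitone_tail : Antitone fun x : ℝ => μ (Ioi x) :=
  fun _ _ h => measure_mono (Ioi_subset_Ioi h)

lemma lintegral_tailMeasure {f : ℝ → ℝ≥0∞} (hf : Measurable f) :
    ∫⁻ x, f x ∂tailMeasure μ = ∫⁻ y, (∫⁻ x in Ico 0 y, f x) ∂μ := by
  rw [tailMeasure, lintegral_withDensity_eq_lintegral_mul _ antitone_tail.measurable hf]
  have hS : MeasurableSet {p : ℝ × ℝ | p.1 < p.2} := measurableSet_lt measurable_fst measurable_snd
  have hm : Measurable ({p : ℝ × ℝ | p.1 < p.2}.indicator fun p => f p.1) :=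
    (hf.comp measurable_fst).indicator hS
  have e1 : ∀ x, ((fun x => μ (Ioi x)) * f) x =
      ∫⁻ y, {p : ℝ × ℝ | p.1 < p.2}.indicator (fun p => f p.1) (x, y) ∂μ := by
    intro x
    have : (fun y => {p : ℝ × ℝ | p.1 < p.2}.indicator (fun p => f p.1) (x, y)) =
        (Ioi x).indicator fun _ => f x := by
      ext y; simp [Set.indicator]
    rw [this, lintegral_indicator_const measurableSet_Ioi, mul_comm, Pi.mul_apply]
  simp_rw [e1]
  rw [lintegral_lintegral_swap (f := fun x y =>
    {p : ℝ × ℝ | p.1 < p.2}.indicator (fun p => f p.1) (x, y)) hm.aemeasurable]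
  refine lintegral_congr fun y => ?_
  rw [← Ici_inter_Iio, inter_comm, ← Measure.restrict_restrict measurableSet_Iio,
    ← lintegral_indicator measurableSet_Iio]
  refine lintegral_congr fun x => ?_
  simp [Set.indicator]

lemma setLIntegral_Ico_sub_left {f : ℝ → ℝ≥0∞} (hf : Measurable f) (a b c : ℝ) :
    ∫⁻ x in Ico a b, f (c - x) = ∫⁻ x in Ico (c - b) (c - a), f x := by
  have h := (volume.measurePreserving_sub_left c).setLIntegral_comp_preimage
    (measurableSet_Ioc (a := c - b) (b := c - a)) hf
  rw [Set.preimage_const_sub_Ioc] at h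
  simp only [sub_sub_cancel] at h
  rw [h]
  exact setLIntegral_congr Ico_ae_eq_Ioc.symm

lemma setLIntegral_Ico_sub_right {f : ℝ → ℝ≥0∞} (hf : Measurable f) (a b c : ℝ) :
    ∫⁻ x in Ico a b, f (x - c) = ∫⁻ x in Ico (a - c) (b - c), f x := by
  have h := (measurePreserving_sub_right volume c).setLIntegral_comp_preimage
    (measurableSet_Ico (a := a - c) (b := b - c)) hf
  rw [Set.preimage_sub_const_Ico] at h
  simpa only [sub_add_cancel] using h

lemma lintegral_Ico_add {f : ℝ → ℝ≥0∞} {a b c : ℝ} (hab : a ≤ b) (hbc : b ≤ c) :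
    (∫⁻ x in Ico a b, f x) + ∫⁻ x in Ico b c, f x = ∫⁻ x in Ico a c, f x := by
  rw [← Ico_union_Ico_eq_Ico hab hbc, lintegral_union measurableSet_Ico Ico_disjoint_Ico_same]

/-- The reflections `x ↦ |x - u|` of `[0, v)` and `x ↦ |x - v|` of `[0, u)` together cover `[0, u)`
and `[0, v)` once each. -/
lemma lintegral_reflect_add {f : ℝ → ℝ≥0∞} (hf : Measurable f) {u v : ℝ} (hu : 0 ≤ u)
    (hv : 0 ≤ v) :
    (∫⁻ x in Ico 0 v, f |x - u|) + ∫⁻ x in Ico 0 u, f |x - v| =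
      (∫⁻ x in Ico 0 u, f x) + ∫⁻ x in Ico 0 v, f x := by
  wlog h : u ≤ v generalizing u v
  · rw [add_comm, this hv hu (le_of_not_ge h), add_comm]
  have e1 : ∫⁻ x in Ico 0 u, f |x - u| = ∫⁻ x in Ico 0 u, f x := by
    have := setLIntegral_Ico_sub_left hf 0 u u
    rw [sub_self, sub_zero] at this
    rw [← this]
    exact setLIntegral_congr_fun measurableSet_Ico fun x hx => by
      rw [abs_sub_comm, abs_of_nonneg (by linarith [hx.2])]
  have e2 : ∫⁻ x in Ico u v, f |x - u| = ∫⁻ x in Ico 0 (v - u), f x := by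
    have := setLIntegral_Ico_sub_right hf u v u
    rw [sub_self] at this
    rw [← this]
    exact setLIntegral_congr_fun measurableSet_Ico fun x hx => by
      rw [abs_of_nonneg (by linarith [hx.1])]
  have e3 : ∫⁻ x in Ico 0 u, f |x - v| = ∫⁻ x in Ico (v - u) v, f x := by
    have := setLIntegral_Ico_sub_left hf 0 u v
    rw [sub_zero] at this
    rw [← this]
    exact setLIntegral_congr_fun measurableSet_Ico fun x hx => by
      rw [abs_sub_comm, abs_of_nonneg (by linarith [hx.2])]
  rw [← lintegral_Ico_add (f := fun x => f |x - u|) hu h, e1, e2, e3, add_assoc,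
    lintegral_Ico_add (by linarith) (by linarith)]

/-- The tail measure is invariant: after symmetrization in two independent increments, this is the
covering property of reflected intervals. -/
lemma invariant_tailMeasure (hnonneg : ∀ᵐ y ∂μ, 0 ≤ y) :
    Kernel.Invariant (transition μ) (tailMeasure μ) := by
  refine invariant_of_lintegral fun f hf => ?_
  rw [lintegral_tailMeasure (measurable_lintegral_step hf), lintegral_tailMeasure hf]
  set Φ : ℝ → ℝ → ℝ≥0∞ := fun v u => ∫⁻ x in Ico 0 v, f |x - u|
  set I : ℝ → ℝ≥0∞ := fun u => ∫⁻ x in Ico 0 u, f x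
  have hΦ : Measurable (Function.uncurry Φ) := by
    have hS : MeasurableSet {p : (ℝ × ℝ) × ℝ | p.2 ∈ Ico 0 p.1.1} :=
      (measurableSet_le measurable_const measurable_snd).inter
        (measurableSet_lt measurable_snd (by fun_prop))
    have hm : Measurable ({p : (ℝ × ℝ) × ℝ | p.2 ∈ Ico 0 p.1.1}.indicator
        fun p => f |p.2 - p.1.2|) := Measurable.indicator (by fun_prop) hS
    convert hm.lintegral_prod_right' (ν := volume) using 2 with p
    simp only [Function.uncurry, Φ]
    rw [← lintegral_indicator measurableSet_Ico]
    rfl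
  have hI : Measurable I := by
    have hS : MeasurableSet {p : ℝ × ℝ | p.2 ∈ Ico 0 p.1} :=
      (measurableSet_le measurable_const measurable_snd).inter
        (measurableSet_lt measurable_snd measurable_fst)
    have hm : Measurable ({p : ℝ × ℝ | p.2 ∈ Ico 0 p.1}.indicator
        fun p => f p.2) := Measurable.indicator (by fun_prop) hS
    convert hm.lintegral_prod_right' (ν := volume) using 2 with p
    simp only [I]
    rw [← lintegral_indicator measurableSet_Ico]
    rfl
  have e1 : ∀ v, (∫⁻ x in Ico 0 v, ∫⁻ u, f |x - u| ∂μ) = ∫⁻ u, Φ v u ∂μ := fun v =>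
    lintegral_lintegral_swap
      (show Measurable fun p : ℝ × ℝ => f |p.1 - p.2| by fun_prop).aemeasurable
  simp_rw [e1]
  have e2 : ∫⁻ v, ∫⁻ u, Φ v u ∂μ ∂μ = ∫⁻ v, ∫⁻ u, Φ u v ∂μ ∂μ :=
    lintegral_lintegral_swap hΦ.aemeasurable
  have e3 : ∫⁻ v, ∫⁻ u, Φ v u ∂μ ∂μ + ∫⁻ v, ∫⁻ u, Φ v u ∂μ ∂μ =
      ∫⁻ u, I u ∂μ + ∫⁻ u, I u ∂μ := by
    conv_lhs => rw [e2]; arg 2; rw [← e2]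
    have hm : Measurable fun v => ∫⁻ u, Φ u v ∂μ :=
      (hΦ.comp measurable_swap).lintegral_prod_right'
    rw [← lintegral_add_left hm]
    have : ∀ᵐ v ∂μ, ∫⁻ u, Φ u v ∂μ + ∫⁻ u, Φ v u ∂μ = I v + ∫⁻ u, I u ∂μ := by
      filter_upwards [hnonneg] with v hv
      have hm' : Measurable fun u => Φ u v := hΦ.comp (measurable_id.prodMk measurable_const)
      rw [← lintegral_add_left hm']
      have : ∀ᵐ u ∂μ, Φ u v + Φ v u = I v + I u := by
        filter_upwards [hnonneg] with u hu using lintegral_reflect_add hf hv hu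
      rw [lintegral_congr_ae this, lintegral_add_left measurable_const]
      simp
    rw [lintegral_congr_ae this, lintegral_add_left hI]
    simp
  rw [← two_mul, ← two_mul] at e3
  exact (ENNReal.mul_right_inj (by simp) (by simp)).1 e3

lemma tailMeasure_univ : tailMeasure μ univ = ∫⁻ y, ENNReal.ofReal y ∂μ := by
  rw [← lintegral_one, lintegral_tailMeasure measurable_const]
  simp

instance : IsFiniteMeasureOnCompacts (tailMeasure μ) := by
  have h : tailMeasure μ ≤ volume := by
    refine Measure.le_intro fun s hs _ => ?_
    rw [tailMeasure, withDensity_apply _ hs]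
    calc ∫⁻ x in s, μ (Ioi x) ∂volume.restrict (Ici 0)
        ≤ ∫⁻ x in s, 1 ∂volume.restrict (Ici 0) := lintegral_mono fun x => prob_le_one
      _ ≤ volume s := by
        rw [lintegral_one, Measure.restrict_apply_univ]
        exact Measure.restrict_apply_le _ _
  exact ⟨fun K hK => (h K).trans_lt hK.measure_lt_top⟩

omit [IsProbabilityMeasure μ] in
lemma support_nonneg (hnonneg : ∀ᵐ y ∂μ, 0 ≤ y) : ∀ s ∈ μ.support, 0 ≤ s :=
  fun _ hs => Measure.support_subset_of_isClosed isClosed_Ici hnonneg hs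

omit [IsProbabilityMeasure μ] in
lemma tail_pos_of_mem_support {x s : ℝ} (hs : s ∈ μ.support) (hxs : x < s) : 0 < μ (Ioi x) :=
  (Measure.mem_support_iff_forall s).1 hs _ (Ioi_mem_nhds hxs)

omit [IsProbabilityMeasure μ] in
lemma exists_pos_mem_support (hnonneg : ∀ᵐ y ∂μ, 0 ≤ y) (hS : ¬ IsLattice μ) :
    ∃ s ∈ μ.support, 0 < s := by
  by_contra! h
  exact hS ⟨1, one_pos, fun s hs =>
    ⟨0, by simpa using le_antisymm (support_nonneg hnonneg s hs) (h s hs)⟩⟩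

omit [IsProbabilityMeasure μ] in
lemma tailMeasure_Ioo_pos {a b : ℝ} (ha : 0 ≤ a) (hab : a < b) (hb : 0 < μ (Ioi b)) :
    0 < tailMeasure μ (Ioo a b) := by
  rw [tailMeasure, withDensity_apply _ measurableSet_Ioo,
    Measure.restrict_restrict measurableSet_Ioo,
    inter_eq_left.2 fun x hx => mem_Ici.2 (ha.trans hx.1.le)]
  calc 0 < μ (Ioi b) * volume (Ioo a b) := by
        rw [Real.volume_Ioo]
        exact ENNReal.mul_pos hb.ne' (by simpa using hab)
    _ = ∫⁻ _ in Ioo a b, μ (Ioi b) := by simp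
    _ ≤ _ := setLIntegral_mono antitone_tail.measurable fun x hx => antitone_tail hx.2.le

omit [IsProbabilityMeasure μ] in
lemma tailMeasure_compl_essInterval :
    tailMeasure μ (essInterval μ)ᶜ = 0 := by
  have h0 : tailMeasure μ (Iio 0) = 0 := by
    rw [tailMeasure, withDensity_apply _ measurableSet_Iio,
      Measure.restrict_restrict measurableSet_Iio]
    rw [Iio_inter_Ici, Ico_self]
    simp
  have h1 : tailMeasure μ {x | μ (Ioi x) = 0} = 0 := by
    have hm : MeasurableSet {x | μ (Ioi x) = 0} :=
      antitone_tail.measurable (measurableSet_singleton 0)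
    rw [tailMeasure, withDensity_apply _ hm]
    exact setLIntegral_eq_zero hm fun x hx => hx
  refine measure_mono_null (fun x hx => ?_) (measure_union_null h0 h1)
  by_contra hcon
  simp only [mem_union, not_or, mem_Iio, not_lt] at hcon
  refine hx ⟨hcon.1, ?_⟩
  obtain ⟨s, hxs, hs⟩ := Measure.nonempty_inter_support_of_pos (pos_iff_ne_zero.2 hcon.2)
  exact (EReal.coe_le_coe_iff.2 (mem_Ioi.1 hxs).le).trans
    (le_iSup₂ (f := fun (y : ℝ) (_ : y ∈ μ.support) => (y : EReal)) s hs)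

lemma isInvariantRadon_tailMeasure (hnonneg : ∀ᵐ y ∂μ, 0 ≤ y) (hS : ¬ IsLattice μ) :
    IsInvariantRadon μ (tailMeasure μ) where
  ne_zero h := by
    obtain ⟨s, hs, hs0⟩ := exists_pos_mem_support hnonneg hS
    have := tailMeasure_Ioo_pos le_rfl (half_pos hs0)
      (tail_pos_of_mem_support hs (half_lt_self hs0))
    simp [h] at this
  concentrated := tailMeasure_compl_essInterval
  finite_on_compacts := inferInstance
  invariant := invariant_tailMeasure hnonneg

end Invariant

/-! ### Conservativity -/

/-- Maharam's recurrence theorem: a measure preserving map is conservative if almost every orbit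
visits infinitely often some fixed set `A` of finite measure. The preimages of a wandering set `W`
are disjoint, so the expected number of visits to `A` from `W` is at most the measure of `A`. -/
lemma conservative_of_ae_frequently_mem {α : Type*} [MeasurableSpace α] {ν : Measure α}
    {T : α → α} (hT : MeasurePreserving T ν ν) {A : Set α} (hA : MeasurableSet A) (hνA : ν A ≠ ∞)
    (h : ∀ᵐ x ∂ν, ∃ᶠ n in atTop, T^[n] x ∈ A) : Conservative T ν := by
  refine ⟨hT.quasiMeasurePreserving, fun W hW hW0 => ?_⟩
  by_contra! hwand
  have hpow : ∀ n, MeasurePreserving T^[n] ν ν := hT.iterate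
  have hbound : ∀ n, ∑ k ∈ Finset.range (n + 1), ν (W ∩ T^[k] ⁻¹' A) ≤ ν A := by
    intro n
    calc ∑ k ∈ Finset.range (n + 1), ν (W ∩ T^[k] ⁻¹' A)
        = ∑ k ∈ Finset.range (n + 1), ν (T^[n - k] ⁻¹' W ∩ T^[n] ⁻¹' A) := by
          refine Finset.sum_congr rfl fun k hk => ?_
          have hk' : k ≤ n := Nat.lt_succ_iff.1 (Finset.mem_range.1 hk)
          rw [← (hpow (n - k)).measure_preimage
            (hW.inter ((hpow k).measurable hA)).nullMeasurableSet, Set.preimage_inter,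
            ← Set.preimage_comp, ← Function.iterate_add, Nat.add_sub_of_le hk']
      _ = ν (⋃ k ∈ Finset.range (n + 1), T^[n - k] ⁻¹' W ∩ T^[n] ⁻¹' A) := by
          refine (measure_biUnion_finset (fun i hi j hj hij => ?_) fun k _ =>
            ((hpow _).measurable hW).inter ((hpow _).measurable hA)).symm
          have main : ∀ i j, i < j → j ≤ n → Disjoint (T^[n - i] ⁻¹' W ∩ T^[n] ⁻¹' A)
              (T^[n - j] ⁻¹' W ∩ T^[n] ⁻¹' A) := by
            intro i j hij hj
            refine Set.disjoint_left.2 fun x hx hx' => hwand _ hx'.1 (j - i) (by lia) ?_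
            rw [← Function.iterate_add_apply, show j - i + (n - j) = n - i by lia]
            exact hx.1
          have hi' : i ≤ n := Nat.lt_succ_iff.1 (Finset.mem_range.1 hi)
          have hj' : j ≤ n := Nat.lt_succ_iff.1 (Finset.mem_range.1 hj)
          rcases lt_or_gt_of_ne hij with hlt | hlt
          · exact main i j hlt hj'
          · exact (main j i hlt hi').symm
      _ ≤ ν (T^[n] ⁻¹' A) := measure_mono (Set.iUnion₂_subset fun _ _ => Set.inter_subset_right)
      _ = ν A := (hpow n).measure_preimage hA.nullMeasurableSet
  have hsum : ∑' k, ν (W ∩ T^[k] ⁻¹' A) ≠ ∞ := by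
    refine ((ENNReal.tsum_le_of_sum_range_le fun n => ?_).trans_lt hνA.lt_top).ne
    exact (Finset.sum_le_sum_of_subset (Finset.range_mono (Nat.le_succ n))).trans (hbound n)
  have hzero := measure_setOfPred_frequently_eq_zero (p := fun k x => x ∈ W ∩ T^[k] ⁻¹' A) hsum
  refine hW0 (measure_mono_null (fun x hx => ?_)
    (measure_union_null hzero (ae_iff.1 h)))
  by_cases hxf : ∃ᶠ n in atTop, T^[n] x ∈ A
  · exact Or.inl (hxf.mono fun n hn => ⟨hx, hn⟩)
  · exact Or.inr hxf

section Recurrence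

variable {μ : Measure ℝ} [IsProbabilityMeasure μ]

/-- The shift on trajectories, coded by the starting point and the sequence of increments. -/
def trajShift (p : ℝ × (ℕ → ℝ)) : ℝ × (ℕ → ℝ) := (|p.1 - p.2 0|, tailSeq p.2)

@[fun_prop]
lemma measurable_trajShift : Measurable trajShift := by unfold trajShift; fun_prop

lemma trajShift_iterate (n : ℕ) (p : ℝ × (ℕ → ℝ)) :
    trajShift^[n] p = (pathWalk n p.1 p.2, fun k => p.2 (k + n)) := by
  induction n generalizing p with
  | zero => rfl
  | succ n ih =>
    rw [Function.iterate_succ_apply, ih]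
    refine Prod.ext rfl (funext fun k => ?_)
    simp [trajShift, tailSeq, add_assoc]

lemma measurePreserving_trajShift {m : Measure ℝ} [SFinite m]
    (hm : Kernel.Invariant (transition μ) m) :
    MeasurePreserving trajShift (m.prod (pathLaw μ)) (m.prod (pathLaw μ)) := by
  refine ⟨measurable_trajShift, Measure.ext fun B hB => ?_⟩
  rw [Measure.map_apply measurable_trajShift hB,
    Measure.prod_apply (measurable_trajShift hB), Measure.prod_apply hB,
    ← lintegral_of_invariant hm (measurable_measure_prodMk_left hB)]
  refine lintegral_congr fun x => ?_
  have hmeas : Measurable fun p : ℝ × (ℕ → ℝ) => (|x - p.1|, p.2) := by fun_prop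
  exact pathLaw_headTail μ (hmeas hB)

/-- By independence the probability `p` that all increments are at most `η` satisfies
`p = μ (-∞, η] * p`. -/
lemma pathLaw_forall_le_eq_zero {η : ℝ} (hη : 0 < μ (Ioi η)) :
    pathLaw μ {y | ∀ k, y k ≤ η} = 0 := by
  have hmeas : MeasurableSet {y : ℕ → ℝ | ∀ k, y k ≤ η} := by
    have : {y : ℕ → ℝ | ∀ k, y k ≤ η} = ⋂ k, {y | y k ≤ η} := by ext; simp
    rw [this]
    exact .iInter fun k => measurableSet_le (measurable_pi_apply k) measurable_const
  have h := pathLaw_headTail μ (measurableSet_Iic (a := η) |>.prod hmeas)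
  have e1 : {y : ℕ → ℝ | (y 0, tailSeq y) ∈ Iic η ×ˢ {y : ℕ → ℝ | ∀ k, y k ≤ η}} =
      {y | ∀ k, y k ≤ η} := by
    ext y
    constructor
    · rintro ⟨h0, h1⟩ k
      cases k with
      | zero => exact h0
      | succ k => exact h1 k
    · exact fun hy => ⟨hy 0, fun k => hy (k + 1)⟩
  set p := pathLaw μ {y | ∀ k, y k ≤ η}
  have e2 : ∀ s, pathLaw μ {y : ℕ → ℝ | (s, y) ∈ Iic η ×ˢ {y : ℕ → ℝ | ∀ k, y k ≤ η}} =
      (Iic η).indicator (fun _ => p) s := by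
    intro s
    by_cases hs : s ≤ η <;> simp [hs, p]
  rw [e1] at h
  simp_rw [e2] at h
  rw [lintegral_indicator_const measurableSet_Iic] at h
  by_contra hp
  have hlt : μ (Iic η) < 1 := by
    rw [← prob_add_prob_compl (μ := μ) (measurableSet_Iic (a := η)), compl_Iic]
    exact ENNReal.lt_add_right (measure_ne_top _ _) hη.ne'
  have := ENNReal.mul_lt_mul_right hp (measure_ne_top _ _) hlt
  rw [mul_one, ← h] at this
  exact lt_irrefl _ this

lemma ae_frequently_lt {η : ℝ} (hη : 0 < μ (Ioi η)) :
    ∀ᵐ y ∂pathLaw μ, ∃ᶠ n in atTop, η < y n := by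
  have h : ∀ᵐ y ∂pathLaw μ, ¬ ∀ k, y k ≤ η := by
    rw [ae_iff]
    simpa only [not_not] using pathLaw_forall_le_eq_zero hη
  have h' : ∀ N, ∀ᵐ y ∂pathLaw μ, ¬ ∀ k, y (k + N) ≤ η := fun N => by
    have := ((measurePreserving_tailSeq μ).iterate N).quasiMeasurePreserving.ae h
    simpa only [iterate_tailSeq] using this
  filter_upwards [ae_all_iff.2 h'] with y hy
  refine frequently_atTop.2 fun N => ?_
  obtain ⟨k, hk⟩ := not_forall.1 (hy N)
  exact ⟨k + N, Nat.le_add_left N k, not_le.1 hk⟩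

/-- A trajectory whose non-negative increments do not tend to zero is reflected infinitely often,
because between reflections it decreases by its increments. -/
lemma frequently_pathWalk_lt {x η : ℝ} (hx : 0 ≤ x) (hη : 0 < η) {y : ℕ → ℝ} (hy : ∀ n, 0 ≤ y n)
    (hfr : ∃ᶠ n in atTop, η < y n) : ∃ᶠ n in atTop, pathWalk n x y < y n := by
  by_contra hcon
  rw [not_frequently, eventually_atTop] at hcon
  obtain ⟨N, hN⟩ := hcon
  have hstep : ∀ k, pathWalk (k + 1 + N) x y = pathWalk (k + N) x y - y (k + N) := by
    intro k
    rw [show k + 1 + N = k + N + 1 by ring, pathWalk_succ', abs_of_nonneg]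
    linarith [hN (k + N) (Nat.le_add_left N k)]
  have hanti : Antitone fun k => pathWalk (k + N) x y :=
    antitone_nat_of_succ_le fun k => by rw [hstep]; linarith [hy (k + N)]
  have hlim := tendsto_atTop_ciInf hanti
    ⟨0, by rintro _ ⟨n, rfl⟩; exact pathWalk_nonneg hx _ _⟩
  have hdiff := hlim.sub (hlim.comp (tendsto_add_atTop_nat 1))
  rw [sub_self] at hdiff
  have hy0 : Tendsto (fun k => y (k + N)) atTop (𝓝 0) := by
    refine hdiff.congr fun k => ?_
    simp only [Function.comp_apply, hstep]; ring
  have hy0' : Tendsto y atTop (𝓝 0) := (tendsto_add_atTop_iff_nat N).1 hy0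
  exact hfr ((hy0'.eventually (gt_mem_nhds hη)).mono fun n hn => not_lt.2 hn.le)

instance : SFinite (tailMeasure μ) := by unfold tailMeasure; infer_instance

omit [IsProbabilityMeasure μ] in
lemma ae_nonneg_tailMeasure : ∀ᵐ x ∂tailMeasure μ, 0 ≤ x := by
  have h : ∀ᵐ x ∂tailMeasure μ, x ∈ essInterval μ := tailMeasure_compl_essInterval
  exact h.mono fun x hx => hx.1

/-- The trajectory shift is conservative for the tail measure: every trajectory is reflected
infinitely often, and the set of trajectories reflected at the first step has measure
`∫ (1 - F)²`. -/
lemma conservative_trajShift (hnonneg : ∀ᵐ y ∂μ, 0 ≤ y) (hS : ¬ IsLattice μ)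
    (htail : ∫⁻ x in Ici (0 : ℝ), μ (Ioi x) ^ 2 < ∞) :
    Conservative trajShift ((tailMeasure μ).prod (pathLaw μ)) := by
  have hA : MeasurableSet {p : ℝ × (ℕ → ℝ) | p.1 < p.2 0} :=
    measurableSet_lt measurable_fst (by fun_prop)
  refine conservative_of_ae_frequently_mem
    (measurePreserving_trajShift (invariant_tailMeasure hnonneg)) hA ?_ ?_
  · have e : ∀ x, pathLaw μ (Prod.mk x ⁻¹' {p : ℝ × (ℕ → ℝ) | p.1 < p.2 0}) = μ (Ioi x) := by
      intro x
      conv_rhs => rw [← map_eval_pathLaw μ 0]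
      rw [Measure.map_apply (by fun_prop) measurableSet_Ioi]
      rfl
    rw [Measure.prod_apply hA]
    simp_rw [e]
    rw [tailMeasure, lintegral_withDensity_eq_lintegral_mul _ antitone_tail.measurable
      antitone_tail.measurable]
    simpa [pow_two] using htail.ne
  · obtain ⟨s, hs, hs0⟩ := exists_pos_mem_support hnonneg hS
    have hpath : ∀ᵐ y ∂pathLaw μ, ∀ n, 0 ≤ y n := by
      refine ae_all_iff.2 fun n => ?_
      refine ae_of_ae_map (measurable_pi_apply n).aemeasurable (p := fun t => 0 ≤ t) ?_
      rwa [map_eval_pathLaw]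
    have hfr := ae_frequently_lt (tail_pos_of_mem_support hs (half_lt_self hs0))
    have h1 := Measure.quasiMeasurePreserving_fst (μ := tailMeasure μ) (ν := pathLaw μ)
      |>.ae ae_nonneg_tailMeasure
    have h2 := Measure.quasiMeasurePreserving_snd (μ := tailMeasure μ) (ν := pathLaw μ)
      |>.ae (hpath.and hfr)
    filter_upwards [h1, h2] with p hp1 hp2
    refine (frequently_pathWalk_lt hp1 (half_pos hs0) hp2.1 hp2.2).mono fun n hn => ?_
    rw [trajShift_iterate]
    simpa using hn

/-! ### Recurrence from every starting point -/

lemma exists_ae_frequently_mem (hnonneg : ∀ᵐ y ∂μ, 0 ≤ y) (hS : ¬ IsLattice μ)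
    (htail : ∫⁻ x in Ici (0 : ℝ), μ (Ioi x) ^ 2 < ∞) {J : Set ℝ} (hJ : MeasurableSet J)
    (hJ0 : tailMeasure μ J ≠ 0) :
    ∃ x ∈ J, 0 ≤ x ∧ ∀ᵐ y ∂pathLaw μ, ∃ᶠ n in atTop, pathWalk n x y ∈ J := by
  have h := (conservative_trajShift hnonneg hS htail).ae_mem_imp_frequently_image_mem
    (measurable_fst hJ).nullMeasurableSet
  have h' := Measure.ae_ae_of_ae_prod h
  obtain ⟨x, hxJ, hx0, hx⟩ :=
    ((frequently_ae_mem_iff.2 hJ0).and_eventually (ae_nonneg_tailMeasure.and h')).exists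
  refine ⟨x, hxJ, hx0, hx.mono fun y hy => ?_⟩
  simpa [trajShift_iterate] using hy hxJ

/-- Every interval of the essential interval is visited infinitely often from every starting point:
some point of a smaller interval returns to it, and by contraction all other walks follow. -/
lemma ae_frequently_mem_Ioo (hnonneg : ∀ᵐ y ∂μ, 0 ≤ y) (hS : ¬ IsLattice μ)
    (htail : ∫⁻ x in Ici (0 : ℝ), μ (Ioi x) ^ 2 < ∞) {x : ℝ} (hx : 0 ≤ x) {a b : ℝ} (hab : a < b)
    (hJ : Ioo a b ⊆ essInterval μ) :
    ∀ᵐ y ∂pathLaw μ, ∃ᶠ n in atTop, pathWalk n x y ∈ Ioo a b := by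
  set c := (a + b) / 2 with hc
  set ρ := (b - a) / 4 with hρ
  have hρ0 : 0 < ρ := by linarith
  have ha' : a < c - ρ := by linarith
  have hb' : c + ρ < b := by linarith
  have h0 : 0 ≤ c - ρ := (hJ (show c - ρ ∈ Ioo a b from ⟨ha', by linarith⟩)).1
  have htop : 0 < μ (Ioi (c + ρ)) := by
    obtain ⟨d, hd1, hd2⟩ := exists_between hb'
    have hd : (d : EReal) ≤ rightEnd μ := (hJ (show d ∈ Ioo a b from ⟨by linarith, hd2⟩)).2
    have hlt : ((c + ρ : ℝ) : EReal) < rightEnd μ := (EReal.coe_lt_coe_iff.2 hd1).trans_le hd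
    obtain ⟨s, hlt'⟩ := lt_iSup_iff.1 hlt
    obtain ⟨hs, hlt'⟩ := lt_iSup_iff.1 hlt'
    exact tail_pos_of_mem_support hs (EReal.coe_lt_coe_iff.1 hlt')
  obtain ⟨v, -, hv0, hv⟩ := exists_ae_frequently_mem hnonneg hS htail measurableSet_Ioo
    (tailMeasure_Ioo_pos h0 (by linarith : c - ρ < c + ρ) htop).ne'
  filter_upwards [hv, ae_tendsto_pairDist_of_frequently_le (z := (x, v))
    (support_nonneg hnonneg) hS hx hv0] with y hy hcontr
  have hlim := hcontr ⟨c + ρ, hy.mono fun n hn => hn.2.le⟩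
  refine (hy.and_eventually (hlim.eventually (gt_mem_nhds hρ0))).mono fun n ⟨hn, hd⟩ => ?_
  have hd' : |pathWalk n x y - pathWalk n v y| < ρ := hd
  rw [abs_lt] at hd'
  exact ⟨by linarith [hn.1, hd'.1], by linarith [hn.2, hd'.2]⟩

/-- The distance of any two walkers with common increments tends to zero almost surely. -/
lemma ae_tendsto_pairDist (hnonneg : ∀ᵐ y ∂μ, 0 ≤ y) (hS : ¬ IsLattice μ)
    (htail : ∫⁻ x in Ici (0 : ℝ), μ (Ioi x) ^ 2 < ∞) {z : ℝ × ℝ} (h1 : 0 ≤ z.1) (h2 : 0 ≤ z.2) :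
    ∀ᵐ y ∂pathLaw μ, Tendsto (fun n => pairDist (pairWalk n z y)) atTop (𝓝 0) := by
  obtain ⟨s, hs, hs0⟩ := exists_pos_mem_support hnonneg hS
  have hsub : Ioo 0 s ⊆ essInterval μ := fun x hx =>
    ⟨hx.1.le, (EReal.coe_le_coe_iff.2 hx.2.le).trans
      (le_iSup₂ (f := fun (y : ℝ) (_ : y ∈ μ.support) => (y : EReal)) s hs)⟩
  filter_upwards [ae_frequently_mem_Ioo hnonneg hS htail h2 hs0 hsub,
    ae_tendsto_pairDist_of_frequently_le (support_nonneg hnonneg) hS h1 h2] with y hy h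
  exact h ⟨s, hy.mono fun n hn => hn.2.le⟩

/-! ### The total mass of invariant measures -/

/-- If one invariant Radon measure is finite, so are all others: by contraction, the expectation of
a bump function `f` along the walk is asymptotically the same for all starting points, which
bounds the product of `∫ f dm₁` with the `m₂`-measure of bounded sets by `m₁ univ * ∫ f dm₂`. -/
lemma measure_univ_lt_top_of_isInvariantRadon (hnonneg : ∀ᵐ y ∂μ, 0 ≤ y) (hS : ¬ IsLattice μ)
    (htail : ∫⁻ x in Ici (0 : ℝ), μ (Ioi x) ^ 2 < ∞) {m₁ m₂ : Measure ℝ}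
    (h₁ : IsInvariantRadon μ m₁) (h₂ : IsInvariantRadon μ m₂) (hfin : m₁ univ < ∞) :
    m₂ univ < ∞ := by
  have := h₂.finite_on_compacts
  have : IsFiniteMeasure m₁ := ⟨hfin⟩
  have hpos : ∀ m, IsInvariantRadon μ m → ∀ᵐ x ∂m, 0 ≤ x := fun m hm => by
    have h : ∀ᵐ x ∂m, x ∈ essInterval μ := hm.concentrated
    exact h.mono fun x hx => hx.1
  let f : ℕ → ℝ → ℝ≥0∞ := fun k x => ENNReal.ofReal (k - |x|)
  have hf : ∀ k, Measurable (f k) := fun k => by fun_prop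
  obtain ⟨k, hk⟩ : ∃ k, ∫⁻ x, f k x ∂m₁ ≠ 0 := by
    by_contra! h
    refine h₁.ne_zero (ae_eq_bot.1 (eventually_false_iff_eq_bot.1 ?_))
    have h' : ∀ k, ∀ᵐ x ∂m₁, f k x = 0 := fun k => (lintegral_eq_zero_iff (hf k)).1 (h k)
    filter_upwards [ae_all_iff.2 h'] with x hx
    obtain ⟨k, hk⟩ := exists_nat_gt |x|
    have := ENNReal.ofReal_eq_zero.1 (hx k)
    linarith
  have hf2 : ∫⁻ x, f k x ∂m₂ ≠ ∞ := by
    refine ne_of_lt ?_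
    calc ∫⁻ x, f k x ∂m₂
        ≤ ∫⁻ x, (Icc (-(k : ℝ)) k).indicator (fun _ => ENNReal.ofReal k) x ∂m₂ := by
          refine lintegral_mono fun x => ?_
          by_cases hx : x ∈ Icc (-(k : ℝ)) k
          · rw [Set.indicator_of_mem hx]
            exact ENNReal.ofReal_le_ofReal (by linarith [abs_nonneg x])
          · rw [Set.indicator_of_notMem hx]
            refine (ENNReal.ofReal_eq_zero.2 ?_).le
            by_contra! h
            exact hx (abs_le.1 (by linarith))
      _ = ENNReal.ofReal k * m₂ (Icc (-(k : ℝ)) k) := lintegral_indicator_const measurableSet_Icc _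
      _ < ∞ := ENNReal.mul_lt_top ENNReal.ofReal_lt_top isCompact_Icc.measure_lt_top
  -- the expected distance of two walkers, truncated at height `k`
  let e : ℕ → ℝ × ℝ → ℝ≥0∞ := fun n z =>
    ∫⁻ y, ENNReal.ofReal (min (pairDist (pairWalk n z y)) k) ∂pathLaw μ
  have hdist : Measurable pairDist := continuous_pairDist.measurable
  have he : ∀ n, Measurable (e n) := fun n => by
    have : Measurable fun p : (ℝ × ℝ) × (ℕ → ℝ) =>
        ENNReal.ofReal (min (pairDist (pairWalk n p.1 p.2)) k) := by fun_prop
    exact this.lintegral_prod_right'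
  have hek : ∀ n z, e n z ≤ ENNReal.ofReal k := fun n z =>
    (lintegral_mono fun y => ENNReal.ofReal_le_ofReal (min_le_right _ _)).trans (by simp)
  have hlim : ∀ z : ℝ × ℝ, 0 ≤ z.1 → 0 ≤ z.2 → Tendsto (fun n => e n z) atTop (𝓝 0) := by
    intro z hz1 hz2
    have : Tendsto (fun n => e n z) atTop (𝓝 (∫⁻ _, 0 ∂pathLaw μ)) := by
      refine tendsto_lintegral_of_dominated_convergence (fun _ => ENNReal.ofReal k)
        (fun n => by fun_prop)
        (fun n => .of_forall fun y => ENNReal.ofReal_le_ofReal (min_le_right _ _)) (by simp) ?_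
      filter_upwards [ae_tendsto_pairDist hnonneg hS htail hz1 hz2] with y hy
      have := ENNReal.tendsto_ofReal (hy.min (tendsto_const_nhds (x := (k : ℝ))))
      simpa using this
    simpa using this
  have hcomp : ∀ n (z : ℝ × ℝ), ∫⁻ y, f k (pathWalk n z.2 y) ∂pathLaw μ ≤
      ∫⁻ y, f k (pathWalk n z.1 y) ∂pathLaw μ + e n z := by
    intro n z
    rw [← lintegral_add_left (by fun_prop)]
    refine lintegral_mono fun y => ?_
    simp only [f]
    set u := pathWalk n z.1 y
    set v := pathWalk n z.2 y
    have hd : pairDist (pairWalk n z y) = |u - v| := rfl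
    rw [hd]
    rcases le_total ((k : ℝ) - |v|) 0 with h0 | h0
    · rw [ENNReal.ofReal_of_nonpos h0]; exact zero_le
    rcases le_total |u - v| k with h1 | h1
    · rw [min_eq_left h1]
      refine (ENNReal.ofReal_le_ofReal ?_).trans ENNReal.ofReal_add_le
      have := abs_sub_abs_le_abs_sub u v
      linarith
    · rw [min_eq_right h1]
      exact (ENNReal.ofReal_le_ofReal (by linarith [abs_nonneg v])).trans le_add_self
  have hbd : ∀ j : ℕ, m₂ (Icc (-(j : ℝ)) j) * ∫⁻ x, f k x ∂m₁ ≤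
      m₁ univ * ∫⁻ x, f k x ∂m₂ := by
    intro j
    set A := Icc (-(j : ℝ)) j
    have hAfin : m₂ A < ∞ := isCompact_Icc.measure_lt_top
    have : IsFiniteMeasure (m₂.restrict A) := ⟨by simpa using hAfin⟩
    set g : ℕ → ℝ → ℝ≥0∞ := fun n x => ∫⁻ y, f k (pathWalk n x y) ∂pathLaw μ
    have hg : ∀ n, Measurable (g n) := fun n =>
      ((hf k).comp (measurable_pathWalk n)).lintegral_prod_right'
    have hn : ∀ n, m₂ A * ∫⁻ x, f k x ∂m₁ ≤ m₁ univ * (∫⁻ x, f k x ∂m₂) +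
        ∫⁻ z, e n z ∂(m₂.restrict A).prod m₁ := by
      intro n
      calc m₂ A * ∫⁻ x, f k x ∂m₁ = ∫⁻ z, g n z.2 ∂(m₂.restrict A).prod m₁ := by
            rw [lintegral_prod (fun z : ℝ × ℝ => g n z.2) ((hg n).comp measurable_snd).aemeasurable]
            simp only [g, lintegral_pathWalk_of_invariant h₁.invariant (hf k) n]
            simp [mul_comm]
        _ ≤ ∫⁻ z, (g n z.1 + e n z) ∂(m₂.restrict A).prod m₁ :=
            lintegral_mono fun z => hcomp n z
        _ = ∫⁻ z, g n z.1 ∂(m₂.restrict A).prod m₁ + ∫⁻ z, e n z ∂(m₂.restrict A).prod m₁ :=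
            lintegral_add_right _ (he n)
        _ ≤ _ := by
            gcongr
            rw [lintegral_prod (fun z : ℝ × ℝ => g n z.1) ((hg n).comp measurable_fst).aemeasurable]
            simp only [lintegral_const]
            rw [lintegral_mul_const _ (hg n), mul_comm]
            refine mul_le_mul' le_rfl ?_
            exact (setLIntegral_le_lintegral A (g n)).trans
              (lintegral_pathWalk_of_invariant h₂.invariant (hf k) n).le
    have hz : Tendsto (fun n => ∫⁻ z, e n z ∂(m₂.restrict A).prod m₁) atTop
        (𝓝 (∫⁻ _, 0 ∂(m₂.restrict A).prod m₁)) := by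
      refine tendsto_lintegral_of_dominated_convergence (fun _ => ENNReal.ofReal k) he
        (fun n => .of_forall (hek n)) ?_ ?_
      · rw [lintegral_const]
        exact ENNReal.mul_ne_top ENNReal.ofReal_ne_top (measure_ne_top _ _)
      · have a1 := Measure.quasiMeasurePreserving_fst (μ := m₂.restrict A) (ν := m₁)
          |>.ae (ae_restrict_of_ae (hpos _ h₂))
        have a2 := Measure.quasiMeasurePreserving_snd (μ := m₂.restrict A) (ν := m₁)
          |>.ae (hpos _ h₁)
        filter_upwards [a1, a2] with z hz1 hz2 using hlim z hz1 hz2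
    rw [lintegral_zero] at hz
    have := ge_of_tendsto' (tendsto_const_nhds.add hz) hn
    simpa using this
  have hun : (univ : Set ℝ) = ⋃ j : ℕ, Icc (-(j : ℝ)) j := by
    refine (Set.eq_univ_of_forall fun x => ?_).symm
    obtain ⟨j, hj⟩ := exists_nat_ge |x|
    exact Set.mem_iUnion.2 ⟨j, abs_le.1 hj⟩
  have hmono : Monotone fun j : ℕ => Icc (-(j : ℝ)) j := fun i j hij => by
    have : (i : ℝ) ≤ j := by exact_mod_cast hij
    exact Icc_subset_Icc (by linarith) this
  have hkfin : ∫⁻ x, f k x ∂m₁ ≠ ∞ := by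
    refine ((lintegral_mono fun x => ENNReal.ofReal_le_ofReal
      (show (k : ℝ) - |x| ≤ k by linarith [abs_nonneg x])).trans_lt ?_).ne
    rw [lintegral_const]
    exact ENNReal.mul_lt_top ENNReal.ofReal_lt_top hfin
  rw [hun, hmono.directed_le.measure_iUnion]
  refine (iSup_le fun j => (ENNReal.le_div_iff_mul_le (Or.inl hk) (Or.inl hkfin)).2
    (hbd j)).trans_lt ?_
  exact ENNReal.div_lt_top (ENNReal.mul_ne_top hfin.ne hf2) hk

lemma tail_sq_eq (x : ℝ) : ENNReal.ofReal ((1 - cdf μ x) ^ 2) = μ (Ioi x) ^ 2 := by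
  rw [ENNReal.ofReal_pow (sub_nonneg.2 (cdf_le_one μ x)), ENNReal.ofReal_sub _ (cdf_nonneg μ x),
    ofReal_cdf, ENNReal.ofReal_one, ← prob_compl_eq_one_sub measurableSet_Iic, compl_Iic]

end Recurrence

end ReflectedWalk

open ReflectedWalk in
theorem theorem4p10 {Ω : Type*} [MeasurableSpace Ω] (P : Measure Ω) [IsProbabilityMeasure P]
    (μ : Measure ℝ) [IsProbabilityMeasure μ] (Y : ℕ → Ω → ℝ)
    (hindep : iIndepFun Y P) (hlaw : ∀ n, HasLaw (Y n) μ P)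
    (hnonneg : ∀ᵐ y ∂μ, 0 ≤ y)
    (hnonlattice : ¬ ReflectedWalk.IsLattice μ)
    (htail : ∫⁻ x in Ici (0 : ℝ), ENNReal.ofReal ((1 - cdf μ x) ^ 2) < ∞) :
    (∀ x : ℝ, 0 ≤ x → ReflectedWalk.IsTopologicallyRecurrent P Y μ x) ∧
    (∫⁻ ω, ENNReal.ofReal (Y 1 ω) ∂P < ∞ →
      ∀ x : ℝ, 0 ≤ x → ReflectedWalk.IsPositiveRecurrent P Y μ x) ∧
    (∫⁻ ω, ENNReal.ofReal (Y 1 ω) ∂P = ∞ →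
      ∀ x : ℝ, 0 ≤ x → ReflectedWalk.IsNullRecurrent P Y μ x) := by
  simp_rw [tail_sq_eq] at htail
  obtain ⟨hmap, hmeas⟩ := map_pathLaw_of_iIndepFun μ hindep hlaw
  have hrec : ∀ x : ℝ, 0 ≤ x → IsTopologicallyRecurrent P Y μ x := by
    intro x hx a b hab hJ
    have h := ae_frequently_mem_Ioo hnonneg hnonlattice htail hx hab hJ
    rw [← hmap] at h
    filter_upwards [ae_of_ae_map hmeas h] with ω hω
    simpa only [walk_eq_pathWalk] using hω
  have hmass : tailMeasure μ univ = ∫⁻ ω, ENNReal.ofReal (Y 1 ω) ∂P := by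
    rw [tailMeasure_univ, ← (hlaw 1).map_eq,
      lintegral_map' (by fun_prop) (hlaw 1).aemeasurable]
  have hinv := isInvariantRadon_tailMeasure hnonneg hnonlattice
  refine ⟨hrec, fun hE x hx => ⟨hrec x hx, ⟨_, hinv⟩, fun m hm => ?_⟩,
    fun hE x hx => ⟨hrec x hx, ⟨_, hinv⟩, fun m hm => ?_⟩⟩
  · exact measure_univ_lt_top_of_isInvariantRadon hnonneg hnonlattice htail hinv hm (hmass ▸ hE)
  · by_contra hne
    have := measure_univ_lt_top_of_isInvariantRadon hnonneg hnonlattice htail hm hinv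
      (lt_top_iff_ne_top.2 hne)
    rw [hmass, hE] at this
    exact lt_irrefl _ this
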